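/- Let $q$ be a prime power, let $\ell$ be $0$ or a prime not dividing $q$, and write $GL_n=GL_n(q)$, $SL_n=SL_n(q)$. An integer is called $\ell'$ if it is prime to $\ell$ (every integer is $\ell'$ when $\ell=0$); an element of a group is $\ell$-regular if its order is $\ell'$; and $O_{\ell'}(G)$ denotes the largest normal subgroup of $\ell'$ order of a finite group $G$. Let $R_n$ be the subgroup with $SL_n\le R_n\le GL_n$ and $R_n/SL_n=O_{\ell'}(GL_n/SL_n)$. For a partition $\lambda$ let $\Delta(\lambda)$ be the greatest common divisor of its parts, and for a multipartition $\underline\lambda=(\lambda^{(1)},\dots,\lambda^{(a)})$ let $\Delta(\underline\lambda)=\gcd(\Delta(\lambda^{(1)}),\dots,\Delta(\lambda^{(a)}))$. For $\lambda\vdash k$ let $J(\lambda)\in GL_k$ be the block-diagonal matrix of unipotent Jordan blocks whose sizes are the parts of $\lambda$. For a nonzero $\sigma\in\overline{\mathbb F}_q$ of degree $d$ over $\mathbb F_q$, let $\iota^\sigma:\mathbb F_{q^d}^\times\to GL_d(q)$ send $x\in\mathbb F_q(\sigma)=\mathbb F_{q^d}$ to the matrix of multiplication by $x$ in the basis $1,\sigma,\dots,\sigma^{d-1}$,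 and let $\iota^\sigma_k: GL_k(q^d)\to GL_{kd}(q)$ be the embedding obtained by replacing each matrix entry by its $d\times d$ multiplication matrix. Let $\sigma_1,\dots,\sigma_a\in\overline{\mathbb F}_q^\times$ be pairwise non-conjugate over $\mathbb F_q$, of degrees $d_1,\dots,d_a$, and let $k_1,\dots,k_a$ be positive integers with $\sum_i k_id_i=n$. Let $s\in GL_n$ be the block-diagonal matrix in which the blocks $\iota^{\sigma_i}(\sigma_i)$ are repeated $k_i$ times, for $i=1,\dots,a$, and assume that $s$ is $\ell$-regular. Let $\underline\lambda=(\lambda^{(1)},\dots,\lambda^{(a)})$ with $\lambda^{(i)}\vdash k_i$, and let $u=\operatorname{diag}\big(\iota^{\sigma_1}_{k_1}(J(\lambda^{(1)})),\dots,\iota^{\sigma_a}_{k_a}(J(\lambda^{(a)}))\big)$ and $g=su$. Then $g\in R_n$, and $$\frac{|g^{GL_n}|}{|g^{R_n}|}=\gcd\big((GL_n:R_n),\Delta(\underline\lambda)\big),$$ where $g^H=\{hgh^{-1}: h\in H\}$. Moreover, the $GL_n$-conjugacy class of $g$ splits into exactly $\gcd\big((GL_n:R_n),\Delta(\underline\lambda)\big)$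 $R_n$-conjugacy classes. -/

import Mathlib

open Matrix IntermediateField

noncomputable section

namespace GLClasses

/-! ### `ℓ'`-notions (`ℓ` is a prime or `0`; for `ℓ = 0` every element and every group is `ℓ'`) -/

/-- `m` is an `ℓ'`-number: prime to `ℓ`, where every number is prime to `ℓ = 0` by convention. -/
def IsPrimeTo (ℓ m : ℕ) : Prop := ℓ = 0 ∨ m.Coprime ℓ

/-- `g` is `ℓ`-regular (an `ℓ'`-element): its order is prime to `ℓ`. -/
def IsRegularElement {G : Type*} [Group G] (ℓ : ℕ) (g : G) : Prop := IsPrimeTo ℓ (orderOf g)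

/-- `O_{ℓ'}(G)`, for a finite group `G`: the largest normal `ℓ'`-subgroup of `G`, that is, the
subgroup generated by all normal subgroups of order prime to `ℓ`. -/
def primeToCore (ℓ : ℕ) (G : Type*) [Group G] : Subgroup G :=
  sSup {N : Subgroup G | N.Normal ∧ IsPrimeTo ℓ (Nat.card N)}

/-! ### Subgroups of `GL_n` -/

/-- `SL_n` as a subgroup of `GL_n`. -/
abbrev SLsub (F : Type*) [Field F] (n : ℕ) : Subgroup (GL (Fin n) F) :=
  (Matrix.GeneralLinearGroup.det : GL (Fin n) F →* Fˣ).ker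

/-- `R_n`: the subgroup with `SL_n ≤ R_n ≤ GL_n` and `R_n / SL_n = O_{ℓ'}(GL_n / SL_n)`. -/
def Rsub (ℓ : ℕ) (F : Type*) [Field F] (n : ℕ) : Subgroup (GL (Fin n) F) :=
  (primeToCore ℓ (GL (Fin n) F ⧸ SLsub F n)).comap (QuotientGroup.mk' (SLsub F n))

/-- `x^R = {r x r⁻¹ | r ∈ R}`, the class of `x ∈ G` under conjugation by the subgroup `R`. -/
def relClass {G : Type*} [Group G] (R : Subgroup G) (x : G) : Set G :=
  {y | ∃ r ∈ R, r * x * r⁻¹ = y}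

/-! ### Block diagonal and Jordan matrices -/

/-- `diag(A_1, …, A_a) ∈ GL_n`, for `A_i ∈ GL_{m_i}` and `m_1 + … + m_a = n`, with the blocks in
this order along the diagonal. -/
def blockDiag {K : Type*} [Field K] {a n : ℕ} (m : Fin a → ℕ) (h : ∑ i, m i = n)
    (A : ∀ i, GL (Fin (m i)) K) : GL (Fin n) K :=
  Units.mapEquiv
    (Matrix.reindexRingEquiv K (finSigmaFinEquiv.trans (finCongr h))).toMulEquiv
    (Units.map (Matrix.blockDiagonal'RingHom (fun i => Fin (m i)) K).toMonoidHom
      (MulEquiv.piUnits.symm A))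

/-- The entries of the unipotent Jordan block of size `m`: ones on the diagonal and just above. -/
def jordanMatrix (K : Type*) [Field K] (m : ℕ) : Matrix (Fin m) (Fin m) K :=
  Matrix.of fun i j => if j.val = i.val ∨ j.val = i.val + 1 then 1 else 0

theorem det_jordanMatrix (K : Type*) [Field K] (m : ℕ) : (jordanMatrix K m).det = 1 := by
  rw [Matrix.det_of_isUpperTriangular]
  · simp [jordanMatrix]
  · intro i j hij
    have h : j.val < i.val := hij
    simp only [jordanMatrix, Matrix.of_apply]
    rw [if_neg (by omega)]

/-- The unipotent Jordan block of size `m` as an element of `GL_m`. -/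
def jordanBlock (K : Type*) [Field K] (m : ℕ) : GL (Fin m) K :=
  Matrix.GeneralLinearGroup.mkOfDetNeZero (jordanMatrix K m)
    (by rw [det_jordanMatrix]; exact one_ne_zero)

/-- The parts `λ_1 ≥ λ_2 ≥ …` of a partition. -/
def sortedParts {k : ℕ} (lam : k.Partition) : List ℕ := lam.parts.sort (· ≥ ·)

theorem sum_sortedParts {k : ℕ} (lam : k.Partition) :
    ∑ i : Fin (sortedParts lam).length, (sortedParts lam).get i = k := by
  have h1 : (sortedParts lam).sum = k := by
    rw [← Multiset.sum_coe, sortedParts, Multiset.sort_eq, lam.parts_sum]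
  calc _ = (sortedParts lam).sum := by simp
    _ = k := h1

/-- The unipotent Jordan matrix `J(λ) = diag(J(λ_1), …, J(λ_m)) ∈ GL_k`, for `λ ⊢ k`. -/
def jordan (K : Type*) [Field K] {k : ℕ} (lam : k.Partition) : GL (Fin k) K :=
  blockDiag (sortedParts lam).get (sum_sortedParts lam) (fun _ => jordanBlock K _)

/-- `Δ(λ)`: the greatest common divisor of the parts of `λ`. -/
def partGcd {k : ℕ} (lam : k.Partition) : ℕ := lam.parts.gcd

/-- `Δ(λ^{(1)}, …, λ^{(a)})`: the greatest common divisor of the `Δ(λ^{(i)})`. -/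
def multiGcd {a : ℕ} {k : Fin a → ℕ} (lam : ∀ i, (k i).Partition) : ℕ :=
  Finset.univ.gcd fun i => partGcd (lam i)

/-! ### The embeddings `ι^σ_k : GL_k(q^d) → GL_{kd}(q)` -/

section Embedding

variable {F : Type*} [Field F] (σ : AlgebraicClosure F)

/-- The degree of `σ` over `F`. -/
def deg : ℕ := (minpoly F σ).natDegree

/-- The basis `1, σ, …, σ^{d-1}` of `F(σ)` over `F`, where `d = deg σ`. -/
def sigmaBasis : Module.Basis (Fin (deg σ)) F F⟮σ⟯ :=
  (adjoin.powerBasis (Algebra.IsIntegral.isIntegral (R := F) σ)).basis.reindex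
    (finCongr (adjoin.powerBasis_dim _))

theorem sigmaBasis_apply (i : Fin (deg σ)) :
    sigmaBasis σ i = AdjoinSimple.gen F σ ^ (i : ℕ) := by
  rw [sigmaBasis, Module.Basis.reindex_apply, PowerBasis.basis_eq_pow, adjoin.powerBasis_gen]
  rfl

/-- Replace each entry `x ∈ F(σ)` of a `k × k` matrix by the `d × d` matrix over `F` of the
multiplication by `x` in the basis `1, σ, …, σ^{d-1}`. -/
def iotaMatrix (k : ℕ) :
    Matrix (Fin k) (Fin k) F⟮σ⟯ →+* Matrix (Fin (k * deg σ)) (Fin (k * deg σ)) F :=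
  ((Matrix.reindexRingEquiv F finProdFinEquiv).toRingHom.comp
    (Matrix.compRingEquiv (Fin k) (Fin (deg σ)) F).toRingHom).comp
    (Algebra.leftMulMatrix (sigmaBasis σ)).toRingHom.mapMatrix

/-- The embedding `ι^σ_k : GL_k(F(σ)) → GL_{kd}(F)`. -/
def iota (k : ℕ) : GL (Fin k) F⟮σ⟯ →* GL (Fin (k * deg σ)) F :=
  Units.map (iotaMatrix σ k).toMonoidHom

theorem gen_ne_zero {σ : AlgebraicClosure F} (h : σ ≠ 0) : AdjoinSimple.gen F σ ≠ 0 := by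
  intro h0
  apply h
  rw [← AdjoinSimple.algebraMap_gen F σ, h0, map_zero]

/-- The scalar matrix `diag(σ, …, σ) ∈ GL_k(F(σ))`. -/
def scalarSigma (h : σ ≠ 0) (k : ℕ) : GL (Fin k) F⟮σ⟯ :=
  Units.map (Matrix.scalar (Fin k)).toMonoidHom (Units.mk0 (AdjoinSimple.gen F σ) (gen_ne_zero h))

end Embedding

/-! ### Standard representatives of the conjugacy classes of `GL_n` -/

/-- The data `σ_1, …, σ_a` and `k_1, …, k_a` of a semisimple class of `GL_n`: nonzero elements of
the algebraic closure of `F`, no two of them conjugate over `F`, and positive integers with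
`∑ k_i deg σ_i = n`. -/
structure SemisimpleDatum (F : Type*) [Field F] (n : ℕ) where
  a : ℕ
  σ : Fin a → AlgebraicClosure F
  σ_ne_zero : ∀ i, σ i ≠ 0
  not_conj : ∀ i j, i ≠ j → ¬ IsConjRoot F (σ i) (σ j)
  k : Fin a → ℕ
  k_pos : ∀ i, 0 < k i
  sum_eq : ∑ i, k i * deg (σ i) = n

variable {F : Type*} [Field F] {n : ℕ}

/-- `s = diag(ι^{σ_1}(σ_1)^{k_1}, …, ι^{σ_a}(σ_a)^{k_a})`, where the exponent `k_i` means that the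
block is repeated `k_i` times: this block-diagonal matrix is `ι^{σ_i}_{k_i}(diag(σ_i, …, σ_i))`. -/
def SemisimpleDatum.s (D : SemisimpleDatum F n) : GL (Fin n) F :=
  blockDiag (fun i => D.k i * deg (D.σ i)) D.sum_eq
    fun i => iota (D.σ i) (D.k i) (scalarSigma (D.σ i) (D.σ_ne_zero i) (D.k i))

/-- `u = diag(ι^{σ_1}_{k_1}(J(λ^{(1)})), …, ι^{σ_a}_{k_a}(J(λ^{(a)})))`. -/
def SemisimpleDatum.u (D : SemisimpleDatum F n) (lam : ∀ i, (D.k i).Partition) :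
    GL (Fin n) F :=
  blockDiag (fun i => D.k i * deg (D.σ i)) D.sum_eq
    fun i => iota (D.σ i) (D.k i) (jordan F⟮D.σ i⟯ (lam i))

end GLClasses

end

/-!
Write `g = s * u` and `Δ` for the greatest common divisor of all parts, let `C` be the centralizer
of `g` in `GL_n`, and `R = R_n`. As `R` is normal, both the quotient of the class sizes and the
number of `R`-classes in the class of `g` are equal to the index of `R ⊔ C`
(`ncard_conjugatesOf_eq_mul`, `ncard_relClass_image_conjugatesOf`). As `R` contains `SL_n`, this
index can be computed in the cyclic group `Fˣ` after applying the determinant, and it is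
`gcd (R.index, Δ)` as soon as `det C` is the group of `Δ`-th powers in `Fˣ`
(`index_sup_of_map_eq_range_powMonoidHom`, `map_det_centralizer`).

Every `Δ`-th power is the determinant of an element of `C`: for `y ∈ F(σ_i)ˣ` and a part `m` of
`λ^{(i)}`, the matrix that is the scalar `y` on the corresponding Jordan block and the identity
elsewhere lies in `C` and its determinant is the `m`-th power of the norm of `y`; the norm of
finite fields is surjective (`exists_centralizer_det_eq_pow`).

Conversely let `h ∈ C`. Since `s` and `u` commute and have coprime orders, `s` is a power of `g`, so
`h` commutes with `u` and with the nilpotent `N = u - 1`. The determinant of `h` is the product of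
its determinants on `ker N ⊓ range (N ^ j)`, by the maps `N : range (N ^ j) → range (N ^ (j + 1))`.
These subspaces decrease with `j`, and a proper inclusion at the step from `j` to `j + 1` happens
only if `j + 1` is the size of a Jordan block, hence a multiple of `Δ`. So the factors come in
groups of `Δ` equal ones, and `det h` is a `Δ`-th power (`exists_pow_eq_det`). The condition on the
block sizes is carried through the embeddings `ι^σ_k` in the equational form `BlocksDvd`.
-/

namespace GLClasses

/-! ### Counting classes under a normal subgroup -/

section Counting

variable {G : Type*} [Group G]

theorem conj_eq_conj_iff {g x y : G} :
    x * g * x⁻¹ = y * g * y⁻¹ ↔ x⁻¹ * y ∈ Subgroup.centralizer {g} := by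
  rw [Subgroup.mem_centralizer_singleton_iff]
  constructor
  · intro h
    calc x⁻¹ * y * g = x⁻¹ * (y * g * y⁻¹) * y := by group
      _ = g * (x⁻¹ * y) := by rw [← h]; group
  · intro h
    calc x * g * x⁻¹ = x * (g * (x⁻¹ * y)) * y⁻¹ := by group
      _ = y * g * y⁻¹ := by rw [← h]; group

/-- If `f` is constant exactly on the left cosets of `H`, its range has `H.index` elements. -/
theorem ncard_range_eq_index {α : Type*} (H : Subgroup G) (f : G → α)
    (hf : ∀ x y, f x = f y ↔ x⁻¹ * y ∈ H) : (Set.range f).ncard = H.index := by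
  have hr : Set.range (fun q : G ⧸ H => f q.out) = Set.range f := by
    ext y
    constructor
    · rintro ⟨q, rfl⟩
      exact ⟨_, rfl⟩
    · rintro ⟨x, rfl⟩
      exact ⟨(x : G ⧸ H), (hf _ _).2 (QuotientGroup.eq.1 (QuotientGroup.out_eq' _))⟩
  rw [← hr, ← Nat.card_coe_set_eq, Subgroup.index]
  refine Nat.card_range_of_injective fun p q h => ?_
  rw [← QuotientGroup.out_eq' p, ← QuotientGroup.out_eq' q]
  exact QuotientGroup.eq.2 ((hf _ _).1 h)

theorem ncard_conjugatesOf (g : G) :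
    (conjugatesOf g).ncard = (Subgroup.centralizer {g}).index := by
  rw [← ncard_range_eq_index _ (fun x => x * g * x⁻¹) fun _ _ => conj_eq_conj_iff]
  congr 1
  ext y
  simp [conjugatesOf, isConj_iff]

theorem ncard_relClass (R : Subgroup G) (g : G) :
    (relClass R g).ncard = (Subgroup.centralizer {g}).relIndex R := by
  rw [Subgroup.relIndex, ← ncard_range_eq_index ((Subgroup.centralizer {g}).subgroupOf R)
    (fun x : R => (x : G) * g * (x : G)⁻¹)
    fun x y => by rw [conj_eq_conj_iff, Subgroup.mem_subgroupOf]; rfl]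
  congr 1
  ext y
  simp [relClass]

theorem mem_relClass_self (R : Subgroup G) (x : G) : x ∈ relClass R x :=
  ⟨1, R.one_mem, by simp⟩

theorem relClass_subset_of_mem {R : Subgroup G} {x y : G} (h : y ∈ relClass R x) :
    relClass R y ⊆ relClass R x := by
  obtain ⟨r, hr, rfl⟩ := h
  rintro _ ⟨t, ht, rfl⟩
  exact ⟨t * r, R.mul_mem ht hr, by group⟩

theorem relClass_eq_iff {R : Subgroup G} {x y : G} :
    relClass R x = relClass R y ↔ y ∈ relClass R x := by
  constructor
  · intro h
    rw [h]
    exact mem_relClass_self R y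
  · intro h
    refine subset_antisymm (relClass_subset_of_mem ?_) (relClass_subset_of_mem h)
    obtain ⟨r, hr, rfl⟩ := h
    exact ⟨r⁻¹, R.inv_mem hr, by group⟩

/-- The number of `R`-classes into which a conjugacy class of `G` splits, for `R` normal. -/
theorem ncard_relClass_image_conjugatesOf (R : Subgroup G) [R.Normal] (g : G) :
    (relClass R '' conjugatesOf g).ncard = (R ⊔ Subgroup.centralizer {g}).index := by
  rw [← ncard_range_eq_index (R ⊔ Subgroup.centralizer {g})
    (fun x => relClass R (x * g * x⁻¹))]
  · congr 1
    ext y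
    simp [conjugatesOf, isConj_iff]
  · intro x y
    rw [relClass_eq_iff, ← SetLike.mem_coe, Subgroup.normal_mul R]
    constructor
    · rintro ⟨r, hr, h⟩
      have h' : (r * x) * g * (r * x)⁻¹ = y * g * y⁻¹ := by rw [← h]; group
      refine ⟨x⁻¹ * r * x, ?_, (r * x)⁻¹ * y, conj_eq_conj_iff.1 h', by group⟩
      simpa using Subgroup.Normal.conj_mem ‹R.Normal› r hr x⁻¹
    · rintro ⟨r, hr, c, hc, h⟩
      have hc' : r * c * g * (r * c)⁻¹ = r * g * r⁻¹ := by
        have := Subgroup.mem_centralizer_singleton_iff.1 hc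
        calc r * c * g * (r * c)⁻¹ = r * (c * g) * c⁻¹ * r⁻¹ := by group
          _ = r * g * r⁻¹ := by rw [this]; group
      refine ⟨x * r * x⁻¹, Subgroup.Normal.conj_mem ‹R.Normal› r hr x, ?_⟩
      have hy : y = x * (r * c) := by
        have h' : r * c = x⁻¹ * y := h
        rw [h']; group
      calc x * r * x⁻¹ * (x * g * x⁻¹) * (x * r * x⁻¹)⁻¹ = x * (r * g * r⁻¹) * x⁻¹ := by group
        _ = x * (r * c * g * (r * c)⁻¹) * x⁻¹ := by rw [hc']
        _ = y * g * y⁻¹ := by rw [hy]; group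

theorem relIndex_sup_of_normal_left [Finite G] (R C : Subgroup G) [R.Normal] :
    C.relIndex (R ⊔ C) = C.relIndex R := by
  have h1 := Subgroup.relIndex_mul_relIndex (R ⊓ C) C (R ⊔ C) inf_le_right le_sup_right
  have h2 := Subgroup.relIndex_mul_relIndex (R ⊓ C) R (R ⊔ C) inf_le_left le_sup_left
  rw [Subgroup.inf_relIndex_right] at h1
  rw [Subgroup.inf_relIndex_left, Subgroup.relIndex_sup_left] at h2
  have hpos : 0 < R.relIndex C := Nat.card_pos
  refine Nat.eq_of_mul_eq_mul_left hpos ?_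
  rw [h1, ← h2, mul_comm]

/-- The relative size of a conjugacy class of `G` and of a class under a normal subgroup. -/
theorem ncard_conjugatesOf_eq_mul [Finite G] (R : Subgroup G) [R.Normal] (g : G) :
    (conjugatesOf g).ncard =
      (R ⊔ Subgroup.centralizer {g}).index * (relClass R g).ncard := by
  rw [ncard_conjugatesOf, ncard_relClass, mul_comm, ← relIndex_sup_of_normal_left R,
    Subgroup.relIndex_mul_index le_sup_right]

end Counting

/-- In a finite cyclic group, joining the `e`-th powers to a subgroup `B` gives a subgroup of index
`gcd (B.index, e)`. -/
theorem index_sup_range_powMonoidHom {A : Type*} [CommGroup A] [IsCyclic A] [Finite A]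
    (B : Subgroup A) (e : ℕ) : (B ⊔ (powMonoidHom e : A →* A).range).index = B.index.gcd e := by
  have h : (powMonoidHom e : A ⧸ B →* A ⧸ B).range
      = (powMonoidHom e : A →* A).range.map (QuotientGroup.mk' B) := by
    ext y
    simp only [MonoidHom.mem_range, Subgroup.mem_map, exists_exists_eq_and]
    exact ⟨fun ⟨x, hx⟩ => by
        obtain ⟨a, rfl⟩ := QuotientGroup.mk'_surjective B x
        exact ⟨a, by rw [← hx]; simp⟩,
      fun ⟨a, ha⟩ => ⟨QuotientGroup.mk' B a, by rw [← ha]; simp⟩⟩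
  have h2 := IsCyclic.index_powMonoidHom_range (G := A ⧸ B) e
  rw [h, Subgroup.index_map, QuotientGroup.ker_mk', QuotientGroup.range_mk', Subgroup.index_top,
    mul_one, sup_comm] at h2
  rw [h2, Subgroup.index]

/-- If `f : G → A` is a surjection onto a finite cyclic group that maps the subgroup `C` onto the
`e`-th powers, and `R` contains the kernel of `f`, then `R ⊔ C` has index `gcd (R.index, e)`. -/
theorem index_sup_of_map_eq_range_powMonoidHom {G A : Type*} [Group G] [CommGroup A] [IsCyclic A]
    [Finite A] (f : G →* A) (hf : Function.Surjective f) (R C : Subgroup G) (hR : f.ker ≤ R)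
    (e : ℕ) (hC : C.map f = (powMonoidHom e : A →* A).range) :
    (R ⊔ C).index = R.index.gcd e := by
  rw [← Subgroup.index_map_eq (R ⊔ C) hf (hR.trans le_sup_left), Subgroup.map_sup, hC,
    index_sup_range_powMonoidHom, Subgroup.index_map_eq R hf hR]

/-! ### The subgroup `R_n` -/

theorem isRegularElement_map {G H : Type*} [Group G] [Group H] {ℓ : ℕ} {g : G}
    (f : G →* H) (hg : IsRegularElement ℓ g) : IsRegularElement ℓ (f g) := by
  rcases hg with h | h
  · exact Or.inl h
  · exact Or.inr (h.coprime_dvd_left (orderOf_map_dvd f g))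

theorem ker_det_le_Rsub (ℓ : ℕ) (F : Type*) [Field F] (n : ℕ) : SLsub F n ≤ Rsub ℓ F n := by
  intro x hx
  rw [Rsub, Subgroup.mem_comap, QuotientGroup.mk'_apply, (QuotientGroup.eq_one_iff x).2 hx]
  exact one_mem _

theorem Rsub_normal (ℓ : ℕ) (F : Type*) [Field F] (n : ℕ) : (Rsub ℓ F n).Normal :=
  ⟨fun r hr x => by
    have : x * r * x⁻¹ = (x * r * x⁻¹ * r⁻¹) * r := by group
    rw [this]
    refine mul_mem (ker_det_le_Rsub ℓ F n ?_) hr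
    simp [MonoidHom.mem_ker, mul_comm]⟩

/-- An element whose determinant is the determinant of an `ℓ`-regular element lies in `R_n`. -/
theorem mem_Rsub_of_det_eq {ℓ : ℕ} {F : Type*} [Field F] {n : ℕ} {s g : GL (Fin n) F}
    (hs : IsRegularElement ℓ s)
    (h : Matrix.GeneralLinearGroup.det g = Matrix.GeneralLinearGroup.det s) :
    g ∈ Rsub ℓ F n := by
  have hq : QuotientGroup.mk' (SLsub F n) g = QuotientGroup.mk' (SLsub F n) s := by
    rw [QuotientGroup.mk'_apply, QuotientGroup.mk'_apply, QuotientGroup.eq]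
    rw [MonoidHom.mem_ker, map_mul, map_inv, h, inv_mul_cancel]
  have hcomm : ∀ x y : GL (Fin n) F ⧸ SLsub F n, x * y = y * x := by
    intro x y
    obtain ⟨x, rfl⟩ := QuotientGroup.mk'_surjective _ x
    obtain ⟨y, rfl⟩ := QuotientGroup.mk'_surjective _ y
    rw [← map_mul, ← map_mul, QuotientGroup.mk'_apply, QuotientGroup.mk'_apply, QuotientGroup.eq]
    rw [MonoidHom.mem_ker, map_mul, map_inv, map_mul, map_mul,
      mul_comm (Matrix.GeneralLinearGroup.det y), inv_mul_cancel]
  rw [Rsub, Subgroup.mem_comap, hq]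
  have hle : Subgroup.zpowers (QuotientGroup.mk' (SLsub F n) s) ≤
      primeToCore ℓ (GL (Fin n) F ⧸ SLsub F n) := by
    refine le_sSup ⟨⟨fun a ha x => ?_⟩, ?_⟩
    · rwa [hcomm x a, mul_inv_cancel_right]
    · rw [Nat.card_zpowers]
      exact isRegularElement_map _ hs
  exact hle (Subgroup.mem_zpowers _)

/-! ### Determinants of maps commuting with a nilpotent map -/

section Det

variable {F V : Type*} [Field F] [AddCommGroup V] [Module F V]

/-- Multiplicativity of the determinant along a surjection `f` intertwining `a` and `b`. -/
theorem det_eq_det_restrict_ker_mul_det [FiniteDimensional F V] {W : Type*} [AddCommGroup W]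
    [Module F W] (f : V →ₗ[F] W) (hf : Function.Surjective f)
    (a : V →ₗ[F] V) (b : W →ₗ[F] W) (hab : ∀ v, f (a v) = b (f v))
    (hk : ∀ v ∈ LinearMap.ker f, a v ∈ LinearMap.ker f) :
    LinearMap.det a = LinearMap.det (a.restrict hk) * LinearMap.det b := by
  rw [LinearMap.det_eq_det_mul_det (LinearMap.ker f) a hk]
  congr 1
  rw [← LinearMap.det_conj _ (f.quotKerEquivOfSurjective hf)]
  congr 1
  ext w
  obtain ⟨v, rfl⟩ := hf w
  have : (f.quotKerEquivOfSurjective hf).symm (f v) = Submodule.Quotient.mk v := by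
    rw [LinearEquiv.symm_apply_eq]; rfl
  simp only [LinearMap.comp_apply, LinearEquiv.coe_coe, this, Submodule.mapQ_apply]
  exact hab v

/-- The determinant of `h` on the submodule `U`, where it is meaningful only if `U` is
`h`-invariant; it is `1` by convention otherwise. -/
noncomputable def detOn (h : V →ₗ[F] V) (U : Submodule F V) : F :=
  open Classical in
  if hU : ∀ v ∈ U, h v ∈ U then LinearMap.det (h.restrict hU) else 1

theorem detOn_top (h : V →ₗ[F] V) : detOn h ⊤ = LinearMap.det h := by
  rw [detOn, dif_pos fun _ _ => Submodule.mem_top]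
  rw [← LinearMap.det_conj _ (Submodule.topEquiv (R := F) (M := V))]
  rfl

theorem detOn_bot (h : V →ₗ[F] V) : detOn h ⊥ = 1 := by
  rw [detOn, dif_pos (by simp)]
  exact LinearMap.det_eq_one_of_subsingleton _

theorem pow_apply_comm {N h : V →ₗ[F] V} (hN : ∀ v, N (h v) = h (N v))
    (j : ℕ) (v : V) : (N ^ j) (h v) = h ((N ^ j) v) := by
  have : Commute N h := LinearMap.ext hN
  exact LinearMap.congr_fun (this.pow_left j).eq v

/-- The map `N` carries `range (N ^ j)` onto `range (N ^ (j + 1))`, with kernel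
`ker N ⊓ range (N ^ j)`. -/
theorem detOn_range_pow [FiniteDimensional F V] {N h : V →ₗ[F] V} (hN : ∀ v, N (h v) = h (N v))
    (j : ℕ) :
    detOn h (LinearMap.range (N ^ j)) =
      detOn h (LinearMap.ker N ⊓ LinearMap.range (N ^ j)) *
        detOn h (LinearMap.range (N ^ (j + 1))) := by
  have hr : ∀ j, ∀ v ∈ LinearMap.range (N ^ j), h v ∈ LinearMap.range (N ^ j) := by
    rintro j _ ⟨w, rfl⟩
    exact ⟨h w, pow_apply_comm hN j w⟩
  have hi : ∀ v ∈ LinearMap.ker N ⊓ LinearMap.range (N ^ j),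
      h v ∈ LinearMap.ker N ⊓ LinearMap.range (N ^ j) := by
    rintro v ⟨hv, hv'⟩
    refine ⟨?_, hr j v hv'⟩
    simp only [SetLike.mem_coe, LinearMap.mem_ker] at hv ⊢
    rw [hN, hv, map_zero]
  rw [detOn, dif_pos (hr j), detOn, dif_pos hi, detOn, dif_pos (hr (j + 1))]
  have hm : ∀ v ∈ LinearMap.range (N ^ j), N v ∈ LinearMap.range (N ^ (j + 1)) := by
    rintro _ ⟨w, rfl⟩
    exact ⟨w, by rw [pow_succ']; rfl⟩
  have hk : ∀ v ∈ LinearMap.ker (N.restrict hm),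
      (h.restrict (hr j)) v ∈ LinearMap.ker (N.restrict hm) := by
    rintro ⟨v, hv⟩ hv'
    rw [LinearMap.mem_ker] at hv' ⊢
    have h1 : N v = 0 := congrArg Subtype.val hv'
    exact Subtype.ext (by change N (h v) = 0; rw [hN, h1, map_zero])
  rw [det_eq_det_restrict_ker_mul_det (N.restrict hm) _ (h.restrict (hr j))
    (h.restrict (hr (j + 1))) _ hk]
  · congr 1
    let φ : LinearMap.ker (N.restrict hm) ≃ₗ[F]
        (LinearMap.ker N ⊓ LinearMap.range (N ^ j) : Submodule F V) :=
      { toFun := fun v => ⟨v.1.1, congrArg Subtype.val v.2, v.1.2⟩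
        invFun := fun v => ⟨⟨v.1, v.2.2⟩, Subtype.ext v.2.1⟩
        map_add' := fun _ _ => rfl
        map_smul' := fun _ _ => rfl
        left_inv := fun _ => rfl
        right_inv := fun _ => rfl }
    rw [← LinearMap.det_conj _ φ]
    rfl
  · rintro ⟨_, w, rfl⟩
    refine ⟨⟨(N ^ j) w, w, rfl⟩, Subtype.ext ?_⟩
    change N ((N ^ j) w) = (N ^ (j + 1)) w
    rw [pow_succ']
    rfl
  · exact fun v => Subtype.ext (hN v.1)

/-- If `ker N ⊓ range (N ^ j)` can only shrink at indices `j + 1` divisible by `e`, the factors of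
the determinant of `h` along the filtration by the ranges of `N ^ j` come in groups of `e` equal
ones. -/
theorem exists_pow_eq_det [FiniteDimensional F V] {N h : V →ₗ[F] V} (hN : ∀ v, N (h v) = h (N v))
    (hnil : IsNilpotent N) {e : ℕ} (he : 0 < e)
    (hgap : ∀ j, ¬ e ∣ j + 1 → ∀ v, N v = 0 → v ∈ LinearMap.range (N ^ j) →
      v ∈ LinearMap.range (N ^ (j + 1))) :
    ∃ y : F, LinearMap.det h = y ^ e := by
  have hstep : ∀ j, ¬ e ∣ j + 1 → LinearMap.ker N ⊓ LinearMap.range (N ^ j) =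
      LinearMap.ker N ⊓ LinearMap.range (N ^ (j + 1)) := by
    intro j hj
    refine le_antisymm (fun v hv => ⟨hv.1, hgap j hj v hv.1 hv.2⟩) (inf_le_inf_left _ ?_)
    rintro _ ⟨w, rfl⟩
    exact ⟨N w, by rw [pow_succ]; rfl⟩
  have hconst : ∀ t i, i < e → LinearMap.ker N ⊓ LinearMap.range (N ^ (e * t + i)) =
      LinearMap.ker N ⊓ LinearMap.range (N ^ (e * t)) := by
    intro t i
    induction i with
    | zero => intro _; rfl
    | succ i ih =>
      intro hi
      rw [← ih (by omega), ← add_assoc, hstep (e * t + i)]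
      intro hd
      rw [add_assoc, Nat.dvd_add_right (dvd_mul_right e t)] at hd
      exact absurd (Nat.le_of_dvd (by omega) hd) (by omega)
  have hgroup : ∀ t i, i ≤ e → detOn h (LinearMap.range (N ^ (e * t))) =
      detOn h (LinearMap.ker N ⊓ LinearMap.range (N ^ (e * t))) ^ i *
        detOn h (LinearMap.range (N ^ (e * t + i))) := by
    intro t i
    induction i with
    | zero => intro _; simp
    | succ i ih =>
      intro hi
      rw [ih (by omega), detOn_range_pow hN (e * t + i), hconst t i (by omega), pow_succ (detOn _ _),
        mul_assoc, add_assoc]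
  have hall : ∀ t, ∃ y : F, LinearMap.det h = y ^ e * detOn h (LinearMap.range (N ^ (e * t))) := by
    intro t
    induction t with
    | zero =>
      exact ⟨1, by
        rw [mul_zero, pow_zero, Module.End.one_eq_id, LinearMap.range_id, detOn_top, one_pow,
          one_mul]⟩
    | succ t ih =>
      obtain ⟨y, hy⟩ := ih
      refine ⟨y * detOn h (LinearMap.ker N ⊓ LinearMap.range (N ^ (e * t))), ?_⟩
      rw [hy, hgroup t e le_rfl, mul_pow, mul_assoc, Nat.mul_succ]
  obtain ⟨M, hM⟩ := hnil
  obtain ⟨y, hy⟩ := hall M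
  have h0 : N ^ (e * M) = 0 := pow_eq_zero_of_le (Nat.le_mul_of_pos_left M he) hM
  rw [h0, LinearMap.range_zero, detOn_bot, mul_one] at hy
  exact ⟨y, hy⟩

end Det

/-! ### Nilpotent elements with nilpotency indices divisible by `e` -/

/-- A ring-theoretic substitute for the condition that all Jordan blocks of the nilpotent `x` have
size divisible by `e`: whenever `e` does not divide `j + 1`, `x ^ j` lies in
`x ^ (j + 1) * S + S * x ^ (j + 1)`. For a matrix this says that a vector killed by `x ^ (j + 1)`
is mapped by `x ^ j` into the range of `x ^ (j + 1)`, so that no block has size `j + 1`. Being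
equational, the condition is inherited by images under ring homomorphisms. -/
def BlocksDvd {S : Type*} [Ring S] (e : ℕ) (x : S) : Prop :=
  IsNilpotent x ∧ ∀ j, ¬ e ∣ j + 1 → ∃ a b : S, x ^ j = x ^ (j + 1) * a + b * x ^ (j + 1)

theorem BlocksDvd.map {S T : Type*} [Ring S] [Ring T] {e : ℕ} {x : S} (hx : BlocksDvd e x)
    (f : S →+* T) : BlocksDvd e (f x) := by
  refine ⟨hx.1.map f, fun j hj => ?_⟩
  obtain ⟨a, b, h⟩ := hx.2 j hj
  exact ⟨f a, f b, by simpa using congrArg f h⟩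

theorem BlocksDvd.pi {ι : Type*} [Finite ι] {S : ι → Type*} [∀ i, Ring (S i)] {e : ℕ}
    {x : ∀ i, S i} (hx : ∀ i, BlocksDvd e (x i)) : BlocksDvd e x := by
  constructor
  · cases nonempty_fintype ι
    choose m hm using fun i => (hx i).1
    exact ⟨∑ i, m i, funext fun i => pow_eq_zero_of_le
      (Finset.single_le_sum (fun _ _ => Nat.zero_le _) (Finset.mem_univ i)) (hm i)⟩
  · intro j hj
    choose a b hab using fun i => (hx i).2 j hj
    exact ⟨a, b, funext hab⟩

/-- The determinant of a matrix commuting with a nilpotent matrix whose blocks have sizes divisible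
by `e` is an `e`-th power. -/
theorem BlocksDvd.exists_pow_eq_det {F : Type*} [Field F] {m : Type*} [Fintype m] [DecidableEq m]
    {e : ℕ} (he : 0 < e) {x h : Matrix m m F} (hx : BlocksDvd e x) (hh : Commute x h) :
    ∃ y : F, h.det = y ^ e := by
  have hx' : BlocksDvd e (Matrix.toLinAlgEquiv' x) :=
    hx.map (Matrix.toLinAlgEquiv' : Matrix m m F ≃ₐ[F] _).toRingEquiv.toRingHom
  have hc : Commute (Matrix.toLinAlgEquiv' x) (Matrix.toLinAlgEquiv' h) := hh.map _
  rw [← LinearMap.det_toLin']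
  refine GLClasses.exists_pow_eq_det (N := Matrix.toLinAlgEquiv' x)
    (h := Matrix.toLinAlgEquiv' h) (LinearMap.congr_fun hc.eq) hx'.1 he ?_
  rintro j hj _ hv ⟨w, rfl⟩
  obtain ⟨a, b, hab⟩ := hx'.2 j hj
  refine ⟨a w, ?_⟩
  have h1 : ((Matrix.toLinAlgEquiv' x) ^ (j + 1)) w = 0 := by rw [pow_succ']; exact hv
  conv_rhs => rw [hab]
  simp [h1]

/-! ### Jordan blocks -/

/-- The `j`-th power of the nilpotent part of a Jordan block is the `j`-th superdiagonal. -/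
theorem jordanMatrix_sub_one_pow_apply (K : Type*) [Field K] (m j : ℕ) (a b : Fin m) :
    ((jordanMatrix K m - 1) ^ j) a b = if b.val = a.val + j then 1 else 0 := by
  induction j generalizing b with
  | zero => simp [Matrix.one_apply, Fin.ext_iff, eq_comm]
  | succ j ih =>
    have hN : ∀ a b : Fin m, (jordanMatrix K m - 1) a b = if b.val = a.val + 1 then 1 else 0 := by
      intro a b
      simp only [jordanMatrix, Matrix.sub_apply, Matrix.of_apply, Matrix.one_apply, Fin.ext_iff]
      split_ifs <;> first | omega | simp
    rw [pow_succ, Matrix.mul_apply]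
    simp only [ih, hN]
    by_cases hb : b.val = a.val + (j + 1)
    · rw [if_pos hb, Finset.sum_eq_single ⟨a.val + j, by omega⟩]
      · simp [hb, add_assoc]
      · intro c _ hc
        rw [if_neg (fun h => hc (Fin.ext h)), zero_mul]
      · simp
    · rw [if_neg hb]
      refine Finset.sum_eq_zero fun c _ => ?_
      split_ifs <;> first | omega | simp

theorem blocksDvd_jordanMatrix (K : Type*) [Field K] {e m : ℕ} (h : e ∣ m) :
    BlocksDvd e (jordanMatrix K m - 1) := by
  constructor
  · refine ⟨m, ?_⟩
    ext a b
    rw [jordanMatrix_sub_one_pow_apply, if_neg (by omega)]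
    rfl
  · intro j hj
    have hne : j + 1 ≠ m := fun h' => hj (h' ▸ h)
    rcases Nat.lt_or_ge m (j + 1) with hlt | hge
    · refine ⟨0, 0, ?_⟩
      ext a b
      rw [jordanMatrix_sub_one_pow_apply, if_neg (by omega)]
      simp
    · -- `x * xᵀ` is the identity up to the last row, which is repaired from the left.
      refine ⟨(jordanMatrix K m - 1)ᵀ,
        Matrix.single ⟨m - 1 - j, by omega⟩ ⟨m - 2 - j, by omega⟩ 1, ?_⟩
      ext a b
      rw [Matrix.add_apply, Matrix.mul_apply, Matrix.mul_apply]
      have h1 : ∑ c, ((jordanMatrix K m - 1) ^ (j + 1)) a c * (jordanMatrix K m - 1)ᵀ c b =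
          if b.val = a.val + j ∧ b.val + 1 < m then 1 else 0 := by
        have hT : ∀ c, (jordanMatrix K m - 1)ᵀ c b = if c.val = b.val + 1 then 1 else 0 := by
          intro c
          simpa using jordanMatrix_sub_one_pow_apply K m 1 b c
        simp only [hT, jordanMatrix_sub_one_pow_apply]
        by_cases hb : b.val + 1 < m
        · rw [Finset.sum_eq_single ⟨b.val + 1, hb⟩]
          · simp only [hb, and_true, if_true, mul_one]
            exact if_congr (by omega) rfl rfl
          · intro c _ hc
            rw [if_neg (c := c.val = b.val + 1) (fun h => hc (Fin.ext h)), mul_zero]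
          · simp
        · rw [if_neg (fun h => hb h.2)]
          refine Finset.sum_eq_zero fun c _ => ?_
          rw [if_neg (c := c.val = b.val + 1) (by omega), mul_zero]
      have h2 : ∑ c, Matrix.single (⟨m - 1 - j, by omega⟩ : Fin m) (⟨m - 2 - j, by omega⟩ : Fin m)
          (1 : K) a c * ((jordanMatrix K m - 1) ^ (j + 1)) c b =
          if b.val = a.val + j ∧ ¬ b.val + 1 < m then 1 else 0 := by
        rw [Finset.sum_eq_single ⟨m - 2 - j, by omega⟩]
        · rw [jordanMatrix_sub_one_pow_apply, Matrix.single_apply]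
          simp only [Fin.ext_iff, and_true]
          split_ifs <;> first | omega | simp
        · intro c _ hc
          rw [Matrix.single_apply, if_neg (fun h => hc h.2.symm), zero_mul]
        · simp
      rw [h1, h2, jordanMatrix_sub_one_pow_apply]
      by_cases hb' : b.val + 1 < m <;> simp [hb']

/-! ### Block diagonal matrices and the embeddings `ι^σ_k` -/

section Block

variable {K : Type*} [Field K] {a n : ℕ} (m : Fin a → ℕ) (h : ∑ i, m i = n)

/-- `blockDiag` as a ring homomorphism on all square matrices. -/
def blockDiagRingHom : (∀ i, Matrix (Fin (m i)) (Fin (m i)) K) →+* Matrix (Fin n) (Fin n) K :=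
  (Matrix.reindexRingEquiv K (finSigmaFinEquiv.trans (finCongr h))).toRingHom.comp
    (Matrix.blockDiagonal'RingHom (fun i => Fin (m i)) K)

theorem coe_blockDiag (A : ∀ i, GL (Fin (m i)) K) :
    (blockDiag m h A : Matrix (Fin n) (Fin n) K) =
      blockDiagRingHom m h fun i => (A i : Matrix (Fin (m i)) (Fin (m i)) K) :=
  rfl

/-- `blockDiag` as a group homomorphism. -/
def blockDiagHom : (∀ i, GL (Fin (m i)) K) →* GL (Fin n) K where
  toFun := blockDiag m h
  map_one' := by simp [blockDiag]
  map_mul' A B := by simp [blockDiag]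

theorem commute_blockDiag {A B : ∀ i, GL (Fin (m i)) K} (hAB : ∀ i, Commute (A i) (B i)) :
    Commute (blockDiag m h A) (blockDiag m h B) :=
  (show Commute A B from funext hAB).map (blockDiagHom m h)

theorem det_blockDiagonal' {ι : Type*} [Fintype ι] [LinearOrder ι] {o : ι → Type*}
    [∀ i, Fintype (o i)] [∀ i, DecidableEq (o i)] (M : ∀ i, Matrix (o i) (o i) K) :
    (Matrix.blockDiagonal' M).det = ∏ i, (M i).det := by
  rw [(Matrix.blockTriangular_blockDiagonal' M).det_fintype]
  refine Finset.prod_congr rfl fun i _ => ?_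
  rw [← Matrix.det_reindex_self (Equiv.sigmaSubtype i)]
  congr 1
  ext x y
  simp [Matrix.toSquareBlock_def, Equiv.sigmaSubtype, Matrix.blockDiagonal'_apply]

theorem det_blockDiag (A : ∀ i, GL (Fin (m i)) K) :
    Matrix.GeneralLinearGroup.det (blockDiag m h A) =
      ∏ i, Matrix.GeneralLinearGroup.det (A i) := by
  ext
  rw [Units.coe_prod]
  change (Matrix.reindex _ _ (Matrix.blockDiagonal' _)).det = _
  rw [Matrix.det_reindex_self, det_blockDiagonal']
  rfl

/-- A block diagonal matrix with a single nontrivial block commutes with every block diagonal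
matrix whose corresponding block commutes with that block. -/
theorem commute_blockDiag_mulSingle {i : Fin a} {x : GL (Fin (m i)) K}
    {B : ∀ i, GL (Fin (m i)) K} (hx : Commute x (B i)) :
    Commute (blockDiag m h (Pi.mulSingle i x)) (blockDiag m h B) := by
  refine commute_blockDiag m h fun j => ?_
  by_cases hj : j = i
  · subst hj
    rwa [Pi.mulSingle_eq_same]
  · rw [Pi.mulSingle_eq_of_ne hj]
    exact Commute.one_left _

theorem det_blockDiag_mulSingle {i : Fin a} (x : GL (Fin (m i)) K) :
    Matrix.GeneralLinearGroup.det (blockDiag m h (Pi.mulSingle i x)) =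
      Matrix.GeneralLinearGroup.det x := by
  rw [det_blockDiag, Finset.prod_eq_single i]
  · rw [Pi.mulSingle_eq_same]
  · intro j _ hj
    rw [Pi.mulSingle_eq_of_ne hj, map_one]
  · simp

end Block

theorem det_iota {F : Type*} [Field F] (σ : AlgebraicClosure F) {k : ℕ} (M : GL (Fin k) F⟮σ⟯) :
    Matrix.GeneralLinearGroup.det (iota σ k M) =
      Units.map (Algebra.norm F) (Matrix.GeneralLinearGroup.det M) := by
  ext
  change (Matrix.reindex finProdFinEquiv finProdFinEquiv (Matrix.comp (Fin k) (Fin k)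
    (Fin (deg σ)) (Fin (deg σ)) F ((Algebra.leftMulMatrix (sigmaBasis σ)).toRingHom.mapMatrix
      (M : Matrix (Fin k) (Fin k) F⟮σ⟯)))).det =
    Algebra.norm F (M : Matrix (Fin k) (Fin k) F⟮σ⟯).det
  rw [Matrix.det_reindex_self, Algebra.norm_eq_matrix_det (sigmaBasis σ)]
  exact (Matrix.det_det (M : Matrix (Fin k) (Fin k) F⟮σ⟯)
    (Algebra.leftMulMatrix (sigmaBasis σ)).toRingHom).symm

/-- The scalar matrix `x` in `GL_k`. -/
def scalarUnit {K : Type*} [Field K] (k : ℕ) : Kˣ →* GL (Fin k) K :=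
  Units.map (Matrix.scalar (Fin k)).toMonoidHom

theorem scalarUnit_commute {K : Type*} [Field K] {k : ℕ} (x : Kˣ) (M : GL (Fin k) K) :
    Commute (scalarUnit k x) M :=
  Units.ext (Matrix.scalar_commute (x : K) (fun _ => Commute.all _ _) _).eq

theorem det_scalarUnit {K : Type*} [Field K] {k : ℕ} (x : Kˣ) :
    Matrix.GeneralLinearGroup.det (scalarUnit k x) = x ^ k := by
  ext
  change (Matrix.scalar (Fin k) (x : K)).det = _
  simp

/-! ### The semisimple and the unipotent part -/

theorem partGcd_dvd_get {k : ℕ} (lam : k.Partition) (j : Fin (sortedParts lam).length) :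
    partGcd lam ∣ (sortedParts lam).get j :=
  Multiset.gcd_dvd ((Multiset.mem_sort _).1 (List.get_mem _ j))

theorem blocksDvd_jordan (K : Type*) [Field K] {k e : ℕ} (lam : k.Partition)
    (he : e ∣ partGcd lam) : BlocksDvd e ((jordan K lam : Matrix (Fin k) (Fin k) K) - 1) := by
  rw [jordan, coe_blockDiag, ← map_one (blockDiagRingHom _ (sum_sortedParts lam)), ← map_sub]
  exact BlocksDvd.map (BlocksDvd.pi fun j =>
    blocksDvd_jordanMatrix K (he.trans (partGcd_dvd_get lam j))) _

theorem det_jordan (K : Type*) [Field K] {k : ℕ} (lam : k.Partition) :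
    Matrix.GeneralLinearGroup.det (jordan K lam) = 1 := by
  rw [jordan, det_blockDiag]
  exact Finset.prod_eq_one fun j _ => Units.ext (det_jordanMatrix K _)

variable {F : Type*} [Field F] {n : ℕ} (D : SemisimpleDatum F n) (lam : ∀ i, (D.k i).Partition)

theorem blocksDvd_u {e : ℕ} (he : e ∣ multiGcd lam) :
    BlocksDvd e ((D.u lam : Matrix (Fin n) (Fin n) F) - 1) := by
  rw [SemisimpleDatum.u, coe_blockDiag, ← map_one (blockDiagRingHom _ D.sum_eq), ← map_sub]
  refine BlocksDvd.map (BlocksDvd.pi fun i => ?_) _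
  have := (blocksDvd_jordan F⟮D.σ i⟯ (lam i)
    (he.trans (Finset.gcd_dvd (Finset.mem_univ i)))).map (iotaMatrix (D.σ i) (D.k i))
  rwa [map_sub, map_one] at this

theorem det_u : Matrix.GeneralLinearGroup.det (D.u lam) = 1 := by
  rw [SemisimpleDatum.u, det_blockDiag]
  exact Finset.prod_eq_one fun i _ => by rw [det_iota, det_jordan, map_one]

instance finite_adjoin [Finite F] (σ : AlgebraicClosure F) : Finite F⟮σ⟯ :=
  have : FiniteDimensional F F⟮σ⟯ :=
    adjoin.finiteDimensional (Algebra.IsIntegral.isIntegral (R := F) σ)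
  Module.finite_of_finite F

/-- The semisimple part has order prime to the characteristic, being built from scalars in the unit
groups of finite fields. -/
theorem exists_coprime_s_pow_eq_one [Finite F] (p : ℕ) [Fact p.Prime] [CharP F p] :
    ∃ M : ℕ, M.Coprime p ∧ D.s ^ M = 1 := by
  refine ⟨∏ i, Nat.card (F⟮D.σ i⟯)ˣ, Nat.Coprime.prod_left fun i _ => ?_, ?_⟩
  · have : CharP F⟮D.σ i⟯ p := charP_of_injective_algebraMap (algebraMap F F⟮D.σ i⟯).injective p
    have hd : p ∣ Nat.card F⟮D.σ i⟯ := by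
      rw [← CharP.cast_eq_zero_iff F⟮D.σ i⟯ p]
      cases nonempty_fintype F⟮D.σ i⟯
      rw [Nat.card_eq_fintype_card, Nat.cast_card_eq_zero]
    rw [Nat.coprime_comm, (Fact.out : p.Prime).coprime_iff_not_dvd, Nat.card_units]
    intro h
    have h1 : p ∣ 1 := (Nat.dvd_sub hd h).trans
      (by rw [Nat.sub_sub_self Nat.card_pos])
    exact (Fact.out : p.Prime).one_lt.ne' (Nat.dvd_one.1 h1)
  · have hA : (fun i => iota (D.σ i) (D.k i) (scalarSigma (D.σ i) (D.σ_ne_zero i) (D.k i))) ^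
        (∏ i, Nat.card (F⟮D.σ i⟯)ˣ) = 1 := by
      funext i
      obtain ⟨c, hc⟩ := Finset.dvd_prod_of_mem (fun i => Nat.card (F⟮D.σ i⟯)ˣ) (Finset.mem_univ i)
      rw [Pi.pow_apply, scalarSigma, ← map_pow, ← map_pow, hc, pow_mul, pow_card_eq_one', one_pow,
        map_one, map_one]
      rfl
    exact (map_pow (blockDiagHom _ D.sum_eq) _ _).symm.trans
      ((congrArg _ hA).trans (map_one (blockDiagHom _ D.sum_eq)))

/-- The order of `u` is a power of the characteristic `p`, as `(u - 1) ^ p ^ r = u ^ p ^ r - 1`. -/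
theorem exists_u_pow_char_pow_eq_one (hn : 0 < n) (p : ℕ) [Fact p.Prime] [CharP F p] :
    ∃ r : ℕ, D.u lam ^ p ^ r = 1 := by
  have : Nonempty (Fin n) := ⟨⟨0, hn⟩⟩
  obtain ⟨m, hm⟩ := (blocksDvd_u D lam (one_dvd _)).1
  refine ⟨m, Units.ext ?_⟩
  have h1 : ((D.u lam : Matrix (Fin n) (Fin n) F) - 1) ^ p ^ m = 0 :=
    pow_eq_zero_of_le (Nat.lt_pow_self (Fact.out : p.Prime).one_lt).le hm
  rw [sub_pow_char_pow_of_commute _ _ (Commute.one_right _), one_pow, sub_eq_zero] at h1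
  simpa using h1

theorem scalarSigma_commute {σ : AlgebraicClosure F} (h : σ ≠ 0) {k : ℕ} (M : GL (Fin k) F⟮σ⟯) :
    Commute (scalarSigma σ h k) M :=
  scalarUnit_commute _ M

theorem commute_s_u : Commute D.s (D.u lam) :=
  commute_blockDiag _ _ fun _ => (scalarSigma_commute _ _).map _

/-- If `s` and `u` commute and have coprime orders, then the centralizer of `s * u` is contained in
that of `u`. -/
theorem commute_of_commute_mul {G : Type*} [Group G] {s u h : G} (hsu : Commute s u) {M P : ℕ}
    (hs : s ^ M = 1) (hu : u ^ P = 1) (hMP : M.Coprime P) (hh : Commute h (s * u)) :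
    Commute h u := by
  -- With `Q ≡ 1` modulo `M` and `Q ≡ 0` modulo `P`, the `Q`-th power of `s * u` is `s`.
  obtain ⟨Q, hQM, hQP⟩ := Nat.chineseRemainder hMP 1 0
  have h1 : (s * u) ^ Q = s := by
    rw [hsu.mul_pow, pow_eq_pow_of_modEq hQM hs, pow_eq_pow_of_modEq hQP hu, pow_one, pow_zero,
      mul_one]
  have h2 : Commute h s := h1 ▸ hh.pow_right Q
  have h3 : u = s⁻¹ * (s * u) := by group
  rw [h3]
  exact h2.inv_right.mul_right hh

/-! ### The determinants of the centralizer -/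

theorem multiGcd_pos (hn : 0 < n) : 0 < multiGcd lam := by
  refine Nat.pos_of_ne_zero fun h0 => ?_
  rw [multiGcd, Finset.gcd_eq_zero_iff] at h0
  have h1 : ∀ i, D.k i = 0 := by
    intro i
    have h2 := h0 i (Finset.mem_univ i)
    rw [partGcd, Multiset.gcd_eq_zero_iff] at h2
    rw [← (lam i).parts_sum]
    exact Multiset.sum_eq_zero h2
  rw [← D.sum_eq] at hn
  simp [h1] at hn

/-- The exponents `m` such that all `m`-th powers lie in a given subgroup are closed under greatest
common divisors. -/
theorem pow_gcd_mem {A : Type*} [CommGroup A] {S : Subgroup A} {m k : ℕ} (hm : ∀ x, x ^ m ∈ S)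
    (hk : ∀ x, x ^ k ∈ S) (x : A) : x ^ Nat.gcd m k ∈ S := by
  rw [← zpow_natCast, Nat.gcd_eq_gcd_ab, _root_.zpow_add, _root_.zpow_mul, _root_.zpow_mul,
    zpow_natCast, zpow_natCast]
  exact mul_mem (S.zpow_mem (hm x) _) (S.zpow_mem (hk x) _)

theorem pow_multisetGcd_mem {A : Type*} [CommGroup A] {S : Subgroup A} {T : Multiset ℕ}
    (hT : ∀ m ∈ T, ∀ x, x ^ m ∈ S) (x : A) : x ^ T.gcd ∈ S := by
  induction T using Multiset.induction generalizing x with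
  | empty => simp
  | cons m T ih =>
    rw [Multiset.gcd_cons]
    exact pow_gcd_mem (hT m (Multiset.mem_cons_self m T))
      (ih fun k hk => hT k (Multiset.mem_cons_of_mem hk)) x

theorem pow_multiGcd_mem {A : Type*} [CommGroup A] {S : Subgroup A}
    (hT : ∀ i, ∀ m ∈ (lam i).parts, ∀ x, x ^ m ∈ S) (x : A) : x ^ multiGcd lam ∈ S := by
  rw [multiGcd, Finset.gcd_def]
  refine pow_multisetGcd_mem (fun m hm => ?_) x
  obtain ⟨i, -, rfl⟩ := Multiset.mem_map.1 hm
  exact fun x => pow_multisetGcd_mem (hT i) x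

/-- For every part `m` occurring in `lam`, each `m`-th power is the determinant of an element
commuting with `s * u`. -/
theorem exists_centralizer_det_eq_pow [Finite F] (i : Fin D.a) {m : ℕ} (hm : m ∈ (lam i).parts)
    (x : Fˣ) : ∃ c : GL (Fin n) F, Commute c (D.s * D.u lam) ∧
      Matrix.GeneralLinearGroup.det c = x ^ m := by
  obtain ⟨y, rfl⟩ := FiniteField.unitsMap_norm_surjective F F⟮D.σ i⟯ x
  have hm' : m ∈ sortedParts (lam i) := (Multiset.mem_sort (· ≥ ·)).2 hm
  obtain ⟨j, rfl⟩ := List.get_of_mem hm'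
  -- The scalar `y` in the `j`-th Jordan block of the `i`-th block, and ones elsewhere.
  refine ⟨blockDiag _ D.sum_eq (Pi.mulSingle i (iota (D.σ i) (D.k i)
    (blockDiag _ (sum_sortedParts (lam i)) (Pi.mulSingle j (scalarUnit _ y))))),
    Commute.mul_right ?_ ?_, ?_⟩
  · exact commute_blockDiag_mulSingle _ _ ((scalarSigma_commute _ _).symm.map (iota _ _))
  · exact commute_blockDiag_mulSingle _ _
      ((commute_blockDiag_mulSingle _ _ (scalarUnit_commute _ _)).map (iota _ _))
  · rw [det_blockDiag_mulSingle, det_iota, det_blockDiag_mulSingle, det_scalarUnit, map_pow]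

/-- The determinants of the elements centralizing `g = s * u` are the `Δ`-th powers, where `Δ` is
the greatest common divisor of all parts. -/
theorem map_det_centralizer [Finite F] (hn : 0 < n) :
    (Subgroup.centralizer {D.s * D.u lam}).map Matrix.GeneralLinearGroup.det =
      (powMonoidHom (multiGcd lam) : Fˣ →* Fˣ).range := by
  apply le_antisymm
  · rintro _ ⟨h, hh, rfl⟩
    have hc : Commute h (D.s * D.u lam) := Subgroup.mem_centralizer_singleton_iff.1 hh
    obtain ⟨p, hp⟩ := CharP.exists F
    have : Fact p.Prime := ⟨CharP.char_is_prime F p⟩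
    obtain ⟨M, hM, hsM⟩ := exists_coprime_s_pow_eq_one D p
    obtain ⟨r, hr⟩ := exists_u_pow_char_pow_eq_one D lam hn p
    have hu : Commute h (D.u lam) :=
      commute_of_commute_mul (commute_s_u D lam) hsM hr (hM.pow_right r) hc
    have hu' : Commute ((D.u lam : Matrix (Fin n) (Fin n) F) - 1) (h : Matrix (Fin n) (Fin n) F) :=
      (Commute.sub_right (congrArg Units.val hu.eq) (Commute.one_right _)).symm
    obtain ⟨y, hy⟩ := (blocksDvd_u D lam dvd_rfl).exists_pow_eq_det (multiGcd_pos D lam hn) hu'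
    have hy0 : y ≠ 0 := by
      rintro rfl
      rw [zero_pow (multiGcd_pos D lam hn).ne'] at hy
      exact (Matrix.GeneralLinearGroup.det h).ne_zero hy
    exact ⟨Units.mk0 y hy0, Units.ext hy.symm⟩
  · rintro _ ⟨x, rfl⟩
    refine pow_multiGcd_mem D lam (fun i m hm x => ?_) x
    obtain ⟨c, hc, hdet⟩ := exists_centralizer_det_eq_pow D lam i hm x
    exact ⟨c, Subgroup.mem_centralizer_singleton_iff.2 hc.eq, hdet⟩

/-- The number of `R_n`-classes in the `GL_n`-class of `s * u`, as an index. -/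
theorem index_Rsub_sup_centralizer [Finite F] (ℓ : ℕ) :
    (Rsub ℓ F n ⊔ Subgroup.centralizer {D.s * D.u lam}).index =
      (Rsub ℓ F n).index.gcd (multiGcd lam) := by
  rcases Nat.eq_zero_or_pos n with rfl | hn
  -- For `n = 0` there are no parts and `Δ = 0`, but `GL_0` is trivial and the index is `1`.
  · have : Subsingleton (Subgroup (GL (Fin 0) F)) := inferInstance
    rw [Subsingleton.elim (Rsub ℓ F 0) ⊤, Subsingleton.elim (⊤ ⊔ _) ⊤, Subgroup.index_top,
      Nat.gcd_one_left]
  · have : Nonempty (Fin n) := ⟨⟨0, hn⟩⟩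
    exact index_sup_of_map_eq_range_powMonoidHom _ Matrix.GeneralLinearGroup.det_surjective _ _
      (ker_det_le_Rsub ℓ F n) _ (map_det_centralizer D lam hn)

end GLClasses

open GLClasses in
theorem mainTheorem9 (F : Type*) [Field F] [Finite F] (ℓ : ℕ) (hℓ : ℓ = 0 ∨ ℓ.Prime)
    (hℓq : ¬ ℓ ∣ Nat.card F) (n : ℕ) (D : SemisimpleDatum F n)
    (hs : IsRegularElement ℓ D.s) (lam : ∀ i, (D.k i).Partition) :
    D.s * D.u lam ∈ Rsub ℓ F n ∧
    ((conjugatesOf (D.s * D.u lam)).ncard : ℚ) / (relClass (Rsub ℓ F n) (D.s * D.u lam)).ncard =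
      (Nat.gcd (Rsub ℓ F n).index (multiGcd lam) : ℚ) ∧
    (relClass (Rsub ℓ F n) '' conjugatesOf (D.s * D.u lam)).ncard =
      Nat.gcd (Rsub ℓ F n).index (multiGcd lam) := by
  have := Rsub_normal ℓ F n
  refine ⟨mem_Rsub_of_det_eq hs (by rw [map_mul, det_u, mul_one]), ?_, ?_⟩
  · rw [ncard_conjugatesOf_eq_mul (Rsub ℓ F n), index_Rsub_sup_centralizer, Nat.cast_mul]
    refine mul_div_cancel_right₀ _ (Nat.cast_ne_zero.2 ?_)
    exact ((Set.ncard_pos (Set.toFinite _)).2 ⟨_, mem_relClass_self _ _⟩).ne'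
  · rw [ncard_relClass_image_conjugatesOf, index_Rsub_sup_centralizer]
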